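/- Let $H$ be a complex Hilbert space (not necessarily separable) and let $T:H\to H$ be a bounded linear operator. For a finite-dimensional subspace $F\subset H$ let $T_F:F\to F$ be the compression of $T$ to $F$, i.e. the composition of the inclusion $F\hookrightarrow H$, the operator $T$, and the orthogonal projection $H\to F$. The finite-dimensional subspaces of $H$ form a directed set under inclusion, so that $(\operatorname{tr}(T_F))_F$ is a net of complex numbers. Call $T$ trace class if $T$ is compact and its singular values (the positive square roots of the non-zero eigenvalues of $T^*T$), counted with multiplicity, are summable. Then $T$ is trace class if and only if the limit $\lim_F\operatorname{tr}(T_F)$ exists in $\mathbb C$. In this case the limit equals the trace of $T$: for every orthonormal basis $(e_i)_{i\in I}$ of $H$ the family $(\langle Te_i,e_i\rangle)_{i\in I}$ is summable and $$\lim_F\operatorname{tr}(T_F)=\operatorname{tr}(T)=\sum_{i\in I}\langle Te_i,e_i\rangle .$$ -/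

import Mathlib

open Filter Topology

universe u

namespace TraceNet

variable {H : Type u} [NormedAddCommGroup H] [InnerProductSpace ℂ H]

/-- The multiplicity of `σ > 0` as a singular value of a compact operator `T`, that is, the
dimension of the eigenspace of `T* T` for the eigenvalue `σ ^ 2` (equivalently of `|T|` for `σ`).
It is `0` if `σ` is not a singular value. -/
noncomputable def singularMultiplicity [CompleteSpace H] (T : H →L[ℂ] H) (σ : ℝ) : ℕ :=
  Module.finrank ℂ
    (Module.End.eigenspace ((T.adjoint ∘L T : H →L[ℂ] H) : H →ₗ[ℂ] H) ((σ : ℂ) ^ 2))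

/-- A trace class operator: a compact operator whose singular values, counted with multiplicity,
are summable. Compactness makes all the multiplicities finite, so that `finrank` is the true
dimension. -/
def IsTraceClass [CompleteSpace H] (T : H →L[ℂ] H) : Prop :=
  IsCompactOperator T ∧
    Summable fun σ : Set.Ioi (0 : ℝ) => (singularMultiplicity T σ : ℝ) * (σ : ℝ)

/-- `t` is the trace of `T`: for every orthonormal basis `(e i)` of `H` the family
`⟪e i, T (e i)⟫` is (unconditionally) summable with sum `t`. Index types in the universe of `H`
suffice, as an orthonormal basis can be indexed by its own elements. -/
def HasTrace (T : H →L[ℂ] H) (t : ℂ) : Prop :=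
  ∀ (ι : Type u) (e : HilbertBasis ι ℂ H), HasSum (fun i => inner ℂ (e i) (T (e i))) t

/-- The finite-dimensional subspaces of `H`, ordered by inclusion. -/
abbrev FinDimSubspace (H : Type u) [NormedAddCommGroup H] [InnerProductSpace ℂ H] : Type u :=
  {F : Submodule ℂ H // FiniteDimensional ℂ F}

instance (F : FinDimSubspace H) : FiniteDimensional ℂ F.1 := F.2

instance : Nonempty (FinDimSubspace H) := ⟨⟨⊥, inferInstance⟩⟩

instance : IsDirectedOrder (FinDimSubspace H) where
  directed F G := ⟨⟨F.1 ⊔ G.1, inferInstance⟩,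
    show F.1 ≤ F.1 ⊔ G.1 from le_sup_left, show G.1 ≤ F.1 ⊔ G.1 from le_sup_right⟩

/-- The compression `T_F : F → H → H → F`: inclusion, then `T`, then the orthogonal projection
onto `F`. -/
noncomputable def compression (T : H →L[ℂ] H) (F : FinDimSubspace H) : F.1 →L[ℂ] F.1 :=
  F.1.orthogonalProjectionOnto ∘L T ∘L F.1.subtypeL

/-- The principal trace minor `tr(T_F)`. -/
noncomputable def traceMinor (T : H →L[ℂ] H) (F : FinDimSubspace H) : ℂ :=
  LinearMap.trace ℂ F.1 (compression T F : F.1 →ₗ[ℂ] F.1)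

end TraceNet

namespace TraceNet

/-! ### Traces of compressions in orthonormal bases. -/

section Minors

variable {H : Type u} [NormedAddCommGroup H] [InnerProductSpace ℂ H]

/-! If `T` is trace class, an eigenbasis `v` of `T* T` has `‖T (v j)‖` summable. Since `tr(T_F) = ∑
⟪v j, P_F T (v j)⟫`, dominated convergence applies as `P_F → 1` strongly; using the spans of finite
parts of an arbitrary orthonormal basis instead of all `F` gives `HasTrace` with the same value.

Conversely, a convergent net of minors is bounded on all of the directed set
(`exists_norm_traceMinor_le`). Splitting compressions into real and imaginary parts, and their
spectra by sign, turns this bound into one on `∑ |⟪g i, T (e i)⟫|` for `e` orthonormal and `g` a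
Bessel family (`sum_norm_inner_le`). The choice `g = T e` shows that `T` is Hilbert–Schmidt, hence
compact; then `g = T e / σ` along singular vectors sums the singular values. -/

theorem traceMinor_eq_sum_orthonormalBasis (T : H →L[ℂ] H) (F : FinDimSubspace H) {ι : Type*}
    [Fintype ι] (b : OrthonormalBasis ι ℂ F.1) :
    traceMinor T F = ∑ i, inner ℂ (b i : H) (T (b i)) := by
  rw [traceMinor, LinearMap.trace_eq_sum_inner _ b]
  refine Finset.sum_congr rfl fun i _ => ?_
  exact Submodule.inner_orthogonalProjectionOnto_eq_of_mem_left (b i) (T (b i))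

theorem traceMinor_eq_sum_orthonormal (T : H →L[ℂ] H) (F : FinDimSubspace H) {ι : Type*}
    [Fintype ι] {v : ι → H} (hv : Orthonormal ℂ v) (hF : Submodule.span ℂ (Set.range v) = F.1) :
    traceMinor T F = ∑ i, inner ℂ (v i) (T (v i)) := by
  have hmem : ∀ i, v i ∈ F.1 := fun i => hF ▸ Submodule.subset_span ⟨i, rfl⟩
  let w : ι → F.1 := fun i => ⟨v i, hmem i⟩
  have hw : Orthonormal ℂ w := by
    refine ⟨fun i => hv.1 i, fun i j hij => hv.2 hij⟩
  have hspan : ⊤ ≤ Submodule.span ℂ (Set.range w) := by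
    rw [← Submodule.map_le_map_iff_of_injective F.1.injective_subtype, Submodule.map_span,
      Submodule.map_top, Submodule.range_subtype, ← Set.range_comp]
    exact hF.ge
  rw [traceMinor_eq_sum_orthonormalBasis T F (OrthonormalBasis.mk hw hspan)]
  simp [w]

theorem traceMinor_span_orthonormal (T : H →L[ℂ] H) {ι : Type*} {v : ι → H}
    (hv : Orthonormal ℂ v) (s : Finset ι) :
    traceMinor T ⟨Submodule.span ℂ (v '' s),
      FiniteDimensional.span_of_finite ℂ (s.finite_toSet.image v)⟩ =
      ∑ i ∈ s, inner ℂ (v i) (T (v i)) := by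
  rw [← Finset.sum_coe_sort s]
  refine traceMinor_eq_sum_orthonormal T _ (hv.comp _ Subtype.val_injective) ?_
  congr 1
  ext x
  simp

theorem traceMinor_sup (T : H →L[ℂ] H) {F K : FinDimSubspace H} (h : F.1 ⟂ K.1) :
    traceMinor T ⟨F.1 ⊔ K.1, inferInstance⟩ = traceMinor T F + traceMinor T K := by
  have bF := stdOrthonormalBasis ℂ F.1
  have bK := stdOrthonormalBasis ℂ K.1
  have ho : Orthonormal ℂ (Sum.elim (fun i => (bF i : H)) (fun i => (bK i : H))) := by
    constructor
    · rintro (i | i)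
      · exact bF.orthonormal.1 i
      · exact bK.orthonormal.1 i
    · rintro (i | i) (j | j) hij
      · exact bF.orthonormal.2 (fun e => hij (by rw [e]))
      · exact Submodule.isOrtho_iff_inner_eq.1 h _ (bF i).2 _ (bK j).2
      · exact Submodule.isOrtho_iff_inner_eq.1 h.symm _ (bK i).2 _ (bF j).2
      · exact bK.orthonormal.2 (fun e => hij (by rw [e]))
  have hspan : ∀ (G : Submodule ℂ H) [FiniteDimensional ℂ G] {n : ℕ}
      (b : OrthonormalBasis (Fin n) ℂ G),
      Submodule.span ℂ (Set.range fun i => (b i : H)) = G := by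
    intro G _ n b
    have := congrArg (Submodule.map G.subtype) b.toBasis.span_eq
    rw [Submodule.map_span, Submodule.map_top, Submodule.range_subtype, ← Set.range_comp] at this
    simpa [Function.comp_def] using this
  rw [traceMinor_eq_sum_orthonormal T _ ho (by
      rw [Set.Sum.elim_range, Submodule.span_union, hspan F.1 bF, hspan K.1 bK]),
    traceMinor_eq_sum_orthonormalBasis T F bF, traceMinor_eq_sum_orthonormalBasis T K bK,
    Fintype.sum_sum_type]
  simp

theorem norm_traceMinor_le (T : H →L[ℂ] H) (F : FinDimSubspace H) :
    ‖traceMinor T F‖ ≤ Module.finrank ℂ F.1 * ‖T‖ := by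
  have b := stdOrthonormalBasis ℂ F.1
  rw [traceMinor_eq_sum_orthonormalBasis T F b]
  refine (norm_sum_le_of_le (f := fun i => inner ℂ (b i : H) (T (b i))) _
    (n := fun _ => ‖T‖) fun i _ => ?_).trans (by simp)
  have h1 : ‖(b i : H)‖ = 1 := b.orthonormal.1 i
  calc ‖inner ℂ (b i : H) (T (b i))‖ ≤ ‖(b i : H)‖ * ‖T (b i)‖ := norm_inner_le_norm _ _
    _ ≤ ‖(b i : H)‖ * (‖T‖ * ‖(b i : H)‖) := by gcongr; exact T.le_opNorm _
    _ = ‖T‖ := by simp [h1]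

end Minors

/-! ### Dominated convergence of the minors. -/

section Limit

variable {H : Type u} [NormedAddCommGroup H] [InnerProductSpace ℂ H] [CompleteSpace H]

/-- Parseval in `v` for each vector of a finite basis of `F`; the outer sum is finite, so the
interchange is free. -/
theorem hasSum_traceMinor (T : H →L[ℂ] H) {κ : Type*} (v : HilbertBasis κ ℂ H)
    (F : FinDimSubspace H) :
    HasSum (fun j => inner ℂ (v j) (F.1.starProjection (T (v j)))) (traceMinor T F) := by
  have b := stdOrthonormalBasis ℂ F.1
  have h : ∀ i ∈ Finset.univ, HasSum
      (fun j => inner ℂ (b i : H) (T (v j)) * inner ℂ (v j) (b i : H))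
      (inner ℂ (b i : H) (T (b i))) := by
    intro i _
    simpa only [ContinuousLinearMap.adjoint_inner_left] using
      v.hasSum_inner_mul_inner (T.adjoint (b i)) (b i)
  have hs := hasSum_sum h
  rw [← traceMinor_eq_sum_orthonormalBasis T F b] at hs
  convert hs using 2 with j
  rw [← Submodule.inner_starProjection_left_eq_right, Submodule.starProjection_apply,
    ← Submodule.inner_orthogonalProjectionOnto_eq_of_mem_left, ← b.sum_inner_mul_inner]
  refine Finset.sum_congr rfl fun i _ => ?_
  rw [Submodule.inner_orthogonalProjectionOnto_eq_of_mem_left,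
    Submodule.inner_orthogonalProjectionOnto_eq_of_mem_right, mul_comm]

theorem tendsto_traceMinor (T : H →L[ℂ] H) {κ : Type*} (v : HilbertBasis κ ℂ H)
    (hv : Summable fun j => ‖T (v j)‖) {α : Type*} {l : Filter α} (G : α → FinDimSubspace H)
    (hG : ∀ x, Tendsto (fun a => (G a).1.starProjection x) l (𝓝 x)) :
    Tendsto (fun a => traceMinor T (G a)) l (𝓝 (∑' j, inner ℂ (v j) (T (v j)))) := by
  have := tendsto_tsum_of_dominated_convergence (𝓕 := l) hv
    (f := fun a j => inner ℂ (v j) ((G a).1.starProjection (T (v j))))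
    (g := fun j => inner ℂ (v j) (T (v j)))
    (fun j => tendsto_const_nhds.inner (hG _)) (Eventually.of_forall fun a j => by
      refine (norm_inner_le_norm _ _).trans ?_
      rw [v.orthonormal.1 j, one_mul]
      exact Submodule.norm_starProjection_apply_le _ _)
  exact this.congr fun a => (hasSum_traceMinor T v (G a)).tsum_eq

theorem tendsto_traceMinor_atTop (T : H →L[ℂ] H) {κ : Type*} (v : HilbertBasis κ ℂ H)
    (hv : Summable fun j => ‖T (v j)‖) :
    Tendsto (traceMinor T) atTop (𝓝 (∑' j, inner ℂ (v j) (T (v j)))) := by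
  refine tendsto_traceMinor T v hv (fun F => F) fun x => ?_
  refine tendsto_const_nhds.congr' ?_
  filter_upwards [eventually_ge_atTop
    (⟨Submodule.span ℂ {x}, inferInstance⟩ : FinDimSubspace H)] with F hF
  exact (Submodule.starProjection_eq_self_iff.2 (hF (Submodule.mem_span_singleton_self x))).symm

theorem hasTrace_tsum (T : H →L[ℂ] H) {κ : Type*} (v : HilbertBasis κ ℂ H)
    (hv : Summable fun j => ‖T (v j)‖) : HasTrace T (∑' j, inner ℂ (v j) (T (v j))) := by
  intro ι e
  have hfin : ∀ s : Finset ι, FiniteDimensional ℂ (Submodule.span ℂ (e '' s)) := fun s =>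
    FiniteDimensional.span_of_finite ℂ (s.finite_toSet.image e)
  have h := tendsto_traceMinor T v hv (l := atTop)
    (fun s : Finset ι => ⟨Submodule.span ℂ (e '' s), hfin s⟩) fun x => by
      refine Submodule.starProjection_tendsto_self
        (fun s : Finset ι => Submodule.span ℂ (e '' s))
        (fun s t hst => Submodule.span_mono (Set.image_mono (by exact_mod_cast hst))) x ?_
      rw [← e.dense_span]
      refine Submodule.topologicalClosure_mono (Submodule.span_le.2 ?_)
      rintro _ ⟨i, rfl⟩
      exact Submodule.mem_iSup_of_mem {i} (Submodule.subset_span (by simp))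
  simpa [HasSum, traceMinor_span_orthonormal T e.orthonormal] using h

end Limit

/-! ### An eigenbasis of `T* T`. -/

section SingularBasis

variable {H : Type u} [NormedAddCommGroup H] [InnerProductSpace ℂ H]

theorem HilbertBasis.summable_const_and_tsum {κ : Type*} (b : HilbertBasis κ ℂ H)
    [FiniteDimensional ℂ H] (c : ℝ) :
    Summable (fun _ : κ => c) ∧ ∑' _ : κ, c = Module.finrank ℂ H * c := by
  have : Finite κ := b.orthonormal.linearIndependent.finite
  have := Fintype.ofFinite κ
  refine ⟨Summable.of_finite, ?_⟩
  rw [tsum_fintype, Module.finrank_eq_card_basis b.toOrthonormalBasis.toBasis]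
  simp

variable [CompleteSpace H]

theorem exists_hilbertBasis_summable_norm {T : H →L[ℂ] H} (hT : IsTraceClass T) :
    ∃ (κ : Type u) (v : HilbertBasis κ ℂ H), Summable fun j => ‖T (v j)‖ := by
  obtain ⟨hc, hsum⟩ := hT
  let S : H →L[ℂ] H := T.adjoint ∘L T
  let E : ℂ → Submodule ℂ H := fun μ => Module.End.eigenspace (S : H →ₗ[ℂ] H) μ
  have hSc : IsCompactOperator S := hc.clm_comp T.adjoint
  have hSs : (S : H →ₗ[ℂ] H).IsSymmetric :=
    (ContinuousLinearMap.isPositive_adjoint_comp_self T).isSymmetric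
  have hE : ∀ μ, CompleteSpace (E μ) := fun μ => by
    have : IsClosed (E μ : Set H) := by
      have : (E μ : Set H) = {x | S x = μ • x} := by
        ext x; simp [E]
      rw [this]
      exact isClosed_eq S.continuous (continuous_const_smul μ)
    exact this.completeSpace_coe
  choose w b _ using fun μ => exists_hilbertBasis ℂ (E μ)
  have ho : Orthonormal ℂ fun a : (μ : ℂ) × w μ => (b a.1 a.2 : H) :=
    hSs.orthogonalFamily_eigenspaces.orthonormal_sigma_orthonormal
    fun μ => (b μ).orthonormal
  have hspan : (Submodule.span ℂ (Set.range fun a : (μ : ℂ) × w μ => (b a.1 a.2 : H)))ᗮ = ⊥ := by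
    rw [eq_bot_iff, ← ContinuousLinearMap.orthogonalComplement_iSup_eigenspaces_eq_bot hSc hSs,
      ← Submodule.iInf_orthogonal]
    intro x hx
    rw [Submodule.mem_iInf]
    intro μ y hy
    have h0 : ∀ i, inner ℂ (b μ i : H) x = 0 := fun i =>
      hx _ (Submodule.subset_span ⟨⟨μ, i⟩, rfl⟩)
    have h1 := (b μ).hasSum_inner_mul_inner ⟨y, hy⟩ ((E μ).orthogonalProjectionOnto x)
    simp only [Submodule.inner_orthogonalProjectionOnto_eq_of_mem_left, h0, mul_zero] at h1
    exact h1.unique hasSum_zero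
  refine ⟨(μ : ℂ) × w μ, HilbertBasis.mkOfOrthogonalEqBot ho hspan, ?_⟩
  rw [HilbertBasis.coe_mkOfOrthogonalEqBot]
  have hnorm : ∀ μ (i : w μ), ((‖T (b μ i)‖ : ℂ)) ^ 2 = μ := by
    intro μ i
    have h1 : S (b μ i) = μ • (b μ i : H) := Module.End.mem_eigenspace_iff.1 (b μ i).2
    have h2 : ‖(b μ i : H)‖ = 1 := (b μ).orthonormal.1 i
    have h3 : inner ℂ (b μ i : H) (S (b μ i)) = inner ℂ (T (b μ i)) (T (b μ i)) := by
      simp [S, ContinuousLinearMap.adjoint_inner_right]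
    rw [h1, inner_smul_right, inner_self_eq_norm_sq_to_K, inner_self_eq_norm_sq_to_K, h2] at h3
    simpa using h3.symm
  have hpos : ∀ σ : Set.Ioi (0 : ℝ), FiniteDimensional ℂ (E ((σ : ℂ) ^ 2)) := fun σ =>
    ContinuousLinearMap.finite_dimensional_eigenspace hSc _
      (pow_ne_zero 2 (by exact_mod_cast (ne_of_gt σ.2)))
  have hval : ∀ (σ : Set.Ioi (0 : ℝ)) (i : w ((σ : ℂ) ^ 2)),
      ‖T (b ((σ : ℂ) ^ 2) i)‖ = σ := by
    intro σ i
    have h := hnorm _ i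
    norm_cast at h
    exact (pow_left_inj₀ (norm_nonneg _) (le_of_lt σ.2) two_ne_zero).1 h
  have hzero : ∀ μ, μ ∉ Set.range (fun σ : Set.Ioi (0 : ℝ) => (σ : ℂ) ^ 2) →
      ∀ i : w μ, ‖T (b μ i)‖ = 0 := by
    intro μ hμ i
    by_contra hne
    exact hμ ⟨⟨_, lt_of_le_of_ne (norm_nonneg _) (Ne.symm hne)⟩, hnorm μ i⟩
  have hinj : Function.Injective (fun σ : Set.Ioi (0 : ℝ) => (σ : ℂ) ^ 2) := by
    intro σ τ h
    have h2 : (σ : ℂ) ^ 2 = (τ : ℂ) ^ 2 := h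
    norm_cast at h2
    exact Subtype.ext ((pow_left_inj₀ (le_of_lt σ.2) (le_of_lt τ.2) two_ne_zero).1 h2)
  rw [summable_sigma_of_nonneg fun _ => norm_nonneg _]
  change (∀ μ, Summable fun i : w μ => ‖T (b μ i)‖) ∧
    Summable fun μ => ∑' i : w μ, ‖T (b μ i)‖
  constructor
  · intro μ
    by_cases hμ : μ ∈ Set.range (fun σ : Set.Ioi (0 : ℝ) => (σ : ℂ) ^ 2)
    · obtain ⟨σ, rfl⟩ := hμ
      have := hpos σ
      simp only [hval]
      exact (HilbertBasis.summable_const_and_tsum (b ((σ : ℂ) ^ 2)) σ).1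
    · simp only [hzero μ hμ]
      exact summable_zero
  -- Only `μ = σ ^ 2` with `σ > 0` contributes, each giving multiplicity times `σ`.
  · rw [← hinj.summable_iff fun μ hμ => by simp [hzero μ hμ]]
    refine hsum.congr fun σ => ?_
    have := hpos σ
    simp only [Function.comp_apply, hval]
    exact (HilbertBasis.summable_const_and_tsum (b ((σ : ℂ) ^ 2)) σ).2.symm

end SingularBasis

/-! ### From bounded minors to trace class. -/

section Bound

/-- The positive and the negative eigenvalues each have absolute sum at most `C`, whence the factor
2. Expanding in the eigenbasis, Cauchy–Schwarz bounds the coefficient of each `|c j|` by `M`. -/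
theorem norm_sum_inner_le_of_isSymmetric {E : Type*} [NormedAddCommGroup E] [InnerProductSpace ℂ E]
    [FiniteDimensional ℂ E] {A : E →ₗ[ℂ] E} (hA : A.IsSymmetric) {C : ℝ}
    (hC : ∀ (n : ℕ) (b : OrthonormalBasis (Fin n) ℂ E) (s : Finset (Fin n)),
      ‖∑ j ∈ s, inner ℂ (b j) (A (b j))‖ ≤ C)
    {ι : Type*} [Fintype ι] {g e : ι → E} {M : ℝ} (hM : 0 ≤ M)
    (he : ∀ x, ∑ i, ‖inner ℂ (e i) x‖ ^ 2 ≤ ‖x‖ ^ 2)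
    (hg : ∀ x, ∑ i, ‖inner ℂ (g i) x‖ ^ 2 ≤ M ^ 2 * ‖x‖ ^ 2) :
    ∑ i, ‖inner ℂ (g i) (A (e i))‖ ≤ 2 * C * M := by
  let b := hA.eigenvectorBasis rfl
  let c := hA.eigenvalues rfl
  have hAb : ∀ j, A (b j) = (c j : ℂ) • b j := fun j => hA.apply_eigenvectorBasis rfl j
  have hdiag : ∀ j, inner ℂ (b j) (A (b j)) = (c j : ℂ) := by
    intro j
    rw [hAb, inner_smul_right, inner_self_eq_norm_sq_to_K, b.orthonormal.1 j]
    simp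
  have hs : ∀ s : Finset _, |∑ j ∈ s, c j| ≤ C := by
    intro s
    have := hC _ b s
    simp only [hdiag] at this
    rwa [← Complex.ofReal_sum, Complex.norm_real] at this
  have hc : ∑ j, |c j| ≤ 2 * C := by
    classical
    rw [← Finset.sum_filter_add_sum_filter_not Finset.univ (fun j => 0 ≤ c j)]
    have h1 : ∑ j with 0 ≤ c j, |c j| = ∑ j with 0 ≤ c j, c j :=
      Finset.sum_congr rfl fun j hj => abs_of_nonneg (Finset.mem_filter.1 hj).2
    have h2 : ∑ j with ¬ 0 ≤ c j, |c j| = - ∑ j with ¬ 0 ≤ c j, c j := by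
      rw [← Finset.sum_neg_distrib]
      exact Finset.sum_congr rfl fun j hj =>
        abs_of_neg (not_le.1 (Finset.mem_filter.1 hj).2)
    have h3 := (abs_le.1 (hs {j | 0 ≤ c j})).2
    have h4 := (abs_le.1 (hs {j | ¬ 0 ≤ c j})).1
    rw [h1, h2]
    linarith
  have hexp : ∀ i, ‖inner ℂ (g i) (A (e i))‖ ≤
      ∑ j, |c j| * (‖inner ℂ (g i) (b j)‖ * ‖inner ℂ (e i) (b j)‖) := by
    intro i
    rw [← b.sum_inner_mul_inner]
    refine norm_sum_le_of_le _ fun j _ => le_of_eq ?_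
    rw [← hA, hAb, inner_smul_left, norm_mul, norm_mul, norm_inner_symm (b j) (e i)]
    simp only [Complex.conj_ofReal, Complex.norm_real, Real.norm_eq_abs]
    ring
  have hcs : ∀ j, ∑ i, ‖inner ℂ (g i) (b j)‖ * ‖inner ℂ (e i) (b j)‖ ≤ M := by
    intro j
    have h1 := he (b j)
    have h2 := hg (b j)
    rw [b.orthonormal.1 j] at h1 h2
    refine le_of_abs_le (abs_le_of_sq_le_sq ?_ hM)
    refine (Finset.sum_mul_sq_le_sq_mul_sq _ _ _).trans ?_
    calc _ ≤ (M ^ 2 * 1 ^ 2) * 1 ^ 2 := by gcongr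
      _ = M ^ 2 := by ring
  calc ∑ i, ‖inner ℂ (g i) (A (e i))‖
      ≤ ∑ i, ∑ j, |c j| * (‖inner ℂ (g i) (b j)‖ * ‖inner ℂ (e i) (b j)‖) :=
        Finset.sum_le_sum fun i _ => hexp i
    _ = ∑ j, |c j| * ∑ i, ‖inner ℂ (g i) (b j)‖ * ‖inner ℂ (e i) (b j)‖ := by
        rw [Finset.sum_comm]
        simp only [Finset.mul_sum]
    _ ≤ ∑ j, |c j| * M := Finset.sum_le_sum fun j _ =>
        mul_le_mul_of_nonneg_left (hcs j) (abs_nonneg _)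
    _ = (∑ j, |c j|) * M := by rw [Finset.sum_mul]
    _ ≤ 2 * C * M := mul_le_mul_of_nonneg_right hc hM

theorem norm_sum_inner_le_of_finiteDimensional {E : Type*} [NormedAddCommGroup E]
    [InnerProductSpace ℂ E] [FiniteDimensional ℂ E] [CompleteSpace E] (S : E →L[ℂ] E) {C : ℝ}
    (hC : ∀ (n : ℕ) (b : OrthonormalBasis (Fin n) ℂ E) (s : Finset (Fin n)),
      ‖∑ j ∈ s, inner ℂ (b j) (S (b j))‖ ≤ C)
    {ι : Type*} [Fintype ι] {g e : ι → E} {M : ℝ} (hM : 0 ≤ M)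
    (he : ∀ x, ∑ i, ‖inner ℂ (e i) x‖ ^ 2 ≤ ‖x‖ ^ 2)
    (hg : ∀ x, ∑ i, ‖inner ℂ (g i) x‖ ^ 2 ≤ M ^ 2 * ‖x‖ ^ 2) :
    ∑ i, ‖inner ℂ (g i) (S (e i))‖ ≤ 4 * C * M := by
  let A : E →L[ℂ] E := realPart S
  let B : E →L[ℂ] E := imaginaryPart S
  have hA : (A : E →ₗ[ℂ] E).IsSymmetric := (realPart S).2.isSymmetric
  have hB : (B : E →ₗ[ℂ] E).IsSymmetric := (imaginaryPart S).2.isSymmetric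
  have hS : ∀ x, S x = A x + Complex.I • B x := fun x => by
    conv_lhs => rw [← realPart_add_I_smul_imaginaryPart S]
    rfl
  have himA : ∀ x, (inner ℂ x (A x)).im = 0 := hA.im_inner_self_apply
  have himB : ∀ x, (inner ℂ x (B x)).im = 0 := hB.im_inner_self_apply
  have hre : ∀ x, inner ℂ x (A x) = ((inner ℂ x (S x)).re : ℂ) := by
    intro x
    apply Complex.ext <;> simp [hS, himA, himB]
  have him : ∀ x, inner ℂ x (B x) = ((inner ℂ x (S x)).im : ℂ) := by
    intro x
    apply Complex.ext <;> simp [hS, himA, himB]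
  have h1 := norm_sum_inner_le_of_isSymmetric hA (C := C) (fun n b s => by
    refine le_trans ?_ (hC n b s)
    simp only [ContinuousLinearMap.coe_coe, hre]
    rw [← Complex.ofReal_sum, Complex.norm_real, ← Complex.re_sum]
    exact Complex.abs_re_le_norm _) hM he hg
  have h2 := norm_sum_inner_le_of_isSymmetric hB (C := C) (fun n b s => by
    refine le_trans ?_ (hC n b s)
    simp only [ContinuousLinearMap.coe_coe, him]
    rw [← Complex.ofReal_sum, Complex.norm_real, ← Complex.im_sum]
    exact Complex.abs_im_le_norm _) hM he hg
  calc ∑ i, ‖inner ℂ (g i) (S (e i))‖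
      ≤ ∑ i, (‖inner ℂ (g i) (A (e i))‖ + ‖inner ℂ (g i) (B (e i))‖) := by
        refine Finset.sum_le_sum fun i _ => ?_
        rw [hS, inner_add_right, inner_smul_right]
        refine (norm_add_le _ _).trans ?_
        simp
    _ ≤ 2 * C * M + 2 * C * M := by
        rw [Finset.sum_add_distrib]
        exact add_le_add h1 h2
    _ = 4 * C * M := by ring

variable {H : Type u} [NormedAddCommGroup H] [InnerProductSpace ℂ H]

theorem sum_norm_inner_le (T : H →L[ℂ] H) {C : ℝ} (hC : ∀ F, ‖traceMinor T F‖ ≤ C)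
    {ι : Type*} [Fintype ι] {g e : ι → H} (he : Orthonormal ℂ e) {M : ℝ} (hM : 0 ≤ M)
    (hg : ∀ x, ∑ i, ‖inner ℂ (g i) x‖ ^ 2 ≤ M ^ 2 * ‖x‖ ^ 2) :
    ∑ i, ‖inner ℂ (g i) (T (e i))‖ ≤ 4 * C * M := by
  obtain ⟨V, hVg, hVe⟩ : ∃ V : FinDimSubspace H, (∀ i, g i ∈ V.1) ∧ ∀ i, e i ∈ V.1 :=
    ⟨⟨Submodule.span ℂ (Set.range g ∪ Set.range e), FiniteDimensional.span_of_finite ℂ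
      ((Set.finite_range g).union (Set.finite_range e))⟩,
      fun i => Submodule.subset_span (Or.inl ⟨i, rfl⟩),
      fun i => Submodule.subset_span (Or.inr ⟨i, rfl⟩)⟩
  let g' : ι → V.1 := fun i => ⟨g i, hVg i⟩
  let e' : ι → V.1 := fun i => ⟨e i, hVe i⟩
  have hcomp : ∀ x y : V.1, inner ℂ x (compression T V y) = inner ℂ (x : H) (T y) := fun x y =>
    Submodule.inner_orthogonalProjectionOnto_eq_of_mem_left x (T y)
  have := norm_sum_inner_le_of_finiteDimensional (compression T V) (C := C) (g := g') (e := e')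
    (fun n b s => by
      have hb : Orthonormal ℂ fun j => (b j : H) :=
        b.orthonormal.comp_linearIsometry V.1.subtypeₗᵢ
      simp only [hcomp]
      rw [← traceMinor_span_orthonormal T hb s]
      exact hC _) hM
    (fun x => he.sum_inner_products_le (x : H)) (fun x => hg x)
  simpa only [hcomp] using this

theorem exists_norm_traceMinor_le {T : H →L[ℂ] H} {t : ℂ}
    (h : Tendsto (traceMinor T) atTop (𝓝 t)) : ∃ C, ∀ F, ‖traceMinor T F‖ ≤ C := by
  obtain ⟨F₀, hF₀⟩ := eventually_atTop.1 (h.norm.eventually_le_const (lt_add_one ‖t‖))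
  refine ⟨‖t‖ + 1 + Module.finrank ℂ F₀.1 * ‖T‖, fun F => ?_⟩
  -- Enlarging `F` to contain `F₀` adds only this complement, of dimension at most that of `F₀`.
  let K : FinDimSubspace H := ⟨F.1ᗮ ⊓ (F.1 ⊔ F₀.1), inferInstance⟩
  have hFK : F.1 ⟂ K.1 := (Submodule.isOrtho_orthogonal_right F.1).mono_right inf_le_left
  have hsup : F.1 ⊔ K.1 = F.1 ⊔ F₀.1 :=
    Submodule.sup_orthogonal_inf_of_hasOrthogonalProjection le_sup_left
  have hadd := traceMinor_sup T hFK
  have h1 := hF₀ ⟨F.1 ⊔ K.1, inferInstance⟩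
    (show F₀.1 ≤ F.1 ⊔ K.1 by rw [hsup]; exact le_sup_right)
  have h2 : Module.finrank ℂ K.1 ≤ Module.finrank ℂ F₀.1 := by
    have h3 := Submodule.finrank_add_inf_finrank_orthogonal
      (le_sup_left : F.1 ≤ F.1 ⊔ F₀.1)
    have h4 := Submodule.finrank_add_le_finrank_add_finrank F.1 F₀.1
    change Module.finrank ℂ ↥(F.1ᗮ ⊓ (F.1 ⊔ F₀.1)) ≤ _
    omega
  have h5 : ‖traceMinor T K‖ ≤ Module.finrank ℂ F₀.1 * ‖T‖ :=
    (norm_traceMinor_le T K).trans (by gcongr)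
  rw [eq_sub_of_add_eq hadd.symm]
  exact (norm_sub_le _ _).trans (add_le_add h1 h5)

variable [CompleteSpace H]

/-- By Cauchy–Schwarz and Bessel, `T` is the operator-norm sum of the rank-one maps `x ↦ ⟪b i, x⟫ T
(b i)`. -/
theorem isCompactOperator_of_summable_norm_sq (T : H →L[ℂ] H) {κ : Type*}
    (b : HilbertBasis κ ℂ H) (hb : Summable fun i => ‖T (b i)‖ ^ 2) : IsCompactOperator T := by
  let R : κ → H →L[ℂ] H := fun i => (innerSL ℂ (b i)).smulRight (T (b i))
  have hR : Summable R := by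
    rw [summable_iff_vanishing_norm]
    intro ε hε
    obtain ⟨s, hs⟩ := summable_iff_vanishing_norm.1 hb ((ε / 2) ^ 2) (by positivity)
    refine ⟨s, fun t ht => lt_of_le_of_lt ?_ (half_lt_self hε)⟩
    refine ContinuousLinearMap.opNorm_le_bound _ (by positivity) fun x => ?_
    have h1 : ∑ i ∈ t, ‖T (b i)‖ ^ 2 ≤ (ε / 2) ^ 2 := (le_abs_self _).trans (hs t ht).le
    have h2 := b.orthonormal.sum_inner_products_le x (s := t)
    have h3 : ‖(∑ i ∈ t, R i) x‖ ≤ ∑ i ∈ t, ‖T (b i)‖ * ‖inner ℂ (b i) x‖ := by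
      rw [sum_apply]
      refine norm_sum_le_of_le _ fun i _ => le_of_eq ?_
      simp [R, norm_smul, mul_comm]
    refine h3.trans (le_of_abs_le (abs_le_of_sq_le_sq ?_ (by positivity)))
    refine (Finset.sum_mul_sq_le_sq_mul_sq _ _ _).trans ?_
    rw [mul_pow]
    gcongr
  have hsum : HasSum R T := by
    have : ∑' i, R i = T := by
      ext x
      have h1 := hR.hasSum.mapL (ContinuousLinearMap.apply ℂ H x)
      have h2 := (b.hasSum_repr x).mapL T
      refine h1.unique ?_
      simpa [R, b.repr_apply_apply] using h2
    exact this ▸ hR.hasSum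
  refine isCompactOperator_of_tendsto hsum (Eventually.of_forall fun s => ?_)
  refine Submodule.sum_mem (compactOperator (RingHom.id ℂ) H H) fun i _ => ?_
  have h1 : IsCompactOperator (ContinuousLinearMap.toSpanSingleton ℂ (T (b i))) :=
    isCompactOperator_of_locallyCompactSpace_rng _
  exact h1.comp_clm (innerSL ℂ (b i))

theorem isCompactOperator_of_norm_traceMinor_le (T : H →L[ℂ] H) {C : ℝ}
    (hC : ∀ F, ‖traceMinor T F‖ ≤ C) : IsCompactOperator T := by
  obtain ⟨w, b, -⟩ := exists_hilbertBasis ℂ H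
  refine isCompactOperator_of_summable_norm_sq T b
    (summable_of_sum_le (c := 4 * C * ‖T‖) (fun i => by positivity) fun s => ?_)
  have ho : Orthonormal ℂ fun i : s => b i := b.orthonormal.comp _ Subtype.val_injective
  have h := sum_norm_inner_le T hC ho (g := fun i : s => T (b i)) (norm_nonneg T) fun x => by
    have h1 := ho.sum_inner_products_le (T.adjoint x) (s := Finset.univ)
    have h2 : ‖T.adjoint x‖ ≤ ‖T‖ * ‖x‖ := by
      simpa using T.adjoint.le_opNorm x
    calc ∑ i : s, ‖inner ℂ (T (b i)) x‖ ^ 2 ≤ ‖T.adjoint x‖ ^ 2 := by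
          simpa only [ContinuousLinearMap.adjoint_inner_right] using h1
      _ ≤ (‖T‖ * ‖x‖) ^ 2 := by gcongr
      _ = ‖T‖ ^ 2 * ‖x‖ ^ 2 := mul_pow _ _ _
  rw [← Finset.sum_coe_sort s]
  simpa [inner_self_eq_norm_sq_to_K] using h

theorem isTraceClass_of_norm_traceMinor_le (T : H →L[ℂ] H) {C : ℝ}
    (hC : ∀ F, ‖traceMinor T F‖ ≤ C) : IsTraceClass T := by
  have hc := isCompactOperator_of_norm_traceMinor_le T hC
  refine ⟨hc, summable_of_sum_le (c := 4 * C * 1)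
    (fun σ => mul_nonneg (Nat.cast_nonneg _) (le_of_lt σ.2)) fun s => ?_⟩
  let S : H →L[ℂ] H := T.adjoint ∘L T
  let E : s → Submodule ℂ H := fun σ =>
    Module.End.eigenspace (S : H →ₗ[ℂ] H) (((σ : Set.Ioi (0 : ℝ)) : ℂ) ^ 2)
  have hSs : (S : H →ₗ[ℂ] H).IsSymmetric :=
    (ContinuousLinearMap.isPositive_adjoint_comp_self T).isSymmetric
  have hpos : ∀ σ : s, (0 : ℝ) < (σ : Set.Ioi (0 : ℝ)) := fun σ => σ.1.2
  have hfin : ∀ σ, FiniteDimensional ℂ (E σ) := fun σ =>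
    ContinuousLinearMap.finite_dimensional_eigenspace (hc.clm_comp T.adjoint) _
      (pow_ne_zero 2 (by exact_mod_cast (hpos σ).ne'))
  have hinj : Function.Injective fun σ : s => ((σ : Set.Ioi (0 : ℝ)) : ℂ) ^ 2 := by
    intro σ τ h
    have h2 : ((σ : Set.Ioi (0 : ℝ)) : ℂ) ^ 2 = ((τ : Set.Ioi (0 : ℝ)) : ℂ) ^ 2 := h
    norm_cast at h2
    exact Subtype.ext (Subtype.ext
      ((pow_left_inj₀ (hpos σ).le (hpos τ).le two_ne_zero).1 h2))
  let e := fun a : (σ : s) × Fin (Module.finrank ℂ (E σ)) =>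
      (stdOrthonormalBasis ℂ (E a.1) a.2 : H)
  have he : Orthonormal ℂ e :=
    (hSs.orthogonalFamily_eigenspaces.comp hinj).orthonormal_sigma_orthonormal
      fun σ => (stdOrthonormalBasis ℂ (E σ)).orthonormal
  let r : (σ : s) × Fin (Module.finrank ℂ (E σ)) → ℝ := fun a => (a.1 : Set.Ioi (0 : ℝ))
  have hr : ∀ a, 0 < r a := fun a => hpos a.1
  have hTT : ∀ a c, inner ℂ (T (e a)) (T (e c)) = (r c : ℂ) ^ 2 * inner ℂ (e a) (e c) := by
    intro a c
    have h1 : S (e c) = ((r c : ℂ) ^ 2) • e c :=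
      Module.End.mem_eigenspace_iff.1 (stdOrthonormalBasis ℂ (E c.1) c.2).2
    rw [← inner_smul_right, ← h1]
    simp [S, ContinuousLinearMap.adjoint_inner_right]
  -- Left singular vectors: orthonormal, and `⟪f a, T (e a)⟫` is the singular value itself.
  let f : (σ : s) × Fin (Module.finrank ℂ (E σ)) → H := fun a => ((r a : ℂ)⁻¹) • T (e a)
  have hfT : ∀ a c, inner ℂ (f a) (T (e c)) = (r a : ℂ)⁻¹ * (r c : ℂ) ^ 2 * inner ℂ (e a) (e c) := by
    intro a c
    change inner ℂ (((r a : ℂ)⁻¹) • T (e a)) (T (e c)) = _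
    rw [inner_smul_left, hTT, map_inv₀, Complex.conj_ofReal, mul_assoc]
  have hf : Orthonormal ℂ f := by
    classical
    rw [orthonormal_iff_ite] at he ⊢
    intro a c
    change inner ℂ (f a) (((r c : ℂ)⁻¹) • T (e c)) = _
    rw [inner_smul_right, hfT, he]
    split_ifs with hac
    · subst hac
      have : (r a : ℂ) ≠ 0 := by exact_mod_cast (hr a).ne'
      field_simp
    · simp
  have h := sum_norm_inner_le T hC he (g := f) zero_le_one fun x => by
    simpa using hf.sum_inner_products_le x (s := Finset.univ)
  have hval : ∀ a, ‖inner ℂ (f a) (T (e a))‖ = r a := by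
    intro a
    have : (r a : ℂ) ≠ 0 := by exact_mod_cast (hr a).ne'
    rw [hfT, inner_self_eq_norm_sq_to_K, he.1 a, pow_two, inv_mul_cancel_left₀ this]
    simp [abs_of_pos (hr a)]
  simp only [hval] at h
  rw [Fintype.sum_sigma] at h
  refine le_trans (le_of_eq ?_) h
  rw [← Finset.sum_coe_sort s]
  refine Finset.sum_congr rfl fun σ _ => ?_
  change _ = ∑ _ : Fin (Module.finrank ℂ (E σ)), ((σ : Set.Ioi (0 : ℝ)) : ℝ)
  rw [Finset.sum_const, Finset.card_univ, Fintype.card_fin, nsmul_eq_mul]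
  rfl

end Bound

end TraceNet

theorem theorem2p1 {H : Type u} [NormedAddCommGroup H] [InnerProductSpace ℂ H] [CompleteSpace H]
    (T : H →L[ℂ] H) :
    (TraceNet.IsTraceClass T ↔ ∃ t : ℂ, Tendsto (TraceNet.traceMinor T) atTop (𝓝 t)) ∧
      (∀ t : ℂ, Tendsto (TraceNet.traceMinor T) atTop (𝓝 t) → TraceNet.HasTrace T t) := by
  have hback : ∀ t : ℂ, Tendsto (TraceNet.traceMinor T) atTop (𝓝 t) →
      TraceNet.IsTraceClass T := fun t ht => by
    obtain ⟨C, hC⟩ := TraceNet.exists_norm_traceMinor_le ht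
    exact TraceNet.isTraceClass_of_norm_traceMinor_le T hC
  refine ⟨⟨fun hT => ?_, fun ⟨t, ht⟩ => hback t ht⟩, fun t ht => ?_⟩
  · obtain ⟨κ, v, hv⟩ := TraceNet.exists_hilbertBasis_summable_norm hT
    exact ⟨_, TraceNet.tendsto_traceMinor_atTop T v hv⟩
  · obtain ⟨κ, v, hv⟩ := TraceNet.exists_hilbertBasis_summable_norm (hback t ht)
    rw [tendsto_nhds_unique ht (TraceNet.tendsto_traceMinor_atTop T v hv)]
    exact TraceNet.hasTrace_tsum T v hv
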